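/- Let $H$ be a finite simple graph with at least one edge. A blow-up graph $G[H]$ of $H$ is a finite simple graph whose vertex set is partitioned into nonempty clusters $A_i$ ($i\in V(H)$) such that edges run only between clusters $A_i,A_j$ with $ij\in E(H)$; its edge densities are $d(A_i,A_j)=\frac{e(A_i,A_j)}{|A_i||A_j|}$ for $ij\in E(H)$, where $e(A_i,A_j)$ is the number of edges between $A_i$ and $A_j$. It contains $H$ as a transversal if there is a graph homomorphism $\varphi:H\to G[H]$ with $\varphi(i)\in A_i$ for all $i\in V(H)$. The critical edge density $d_{crit}(H)$ is the supremum of the real numbers $d$ for which there is a blow-up graph of $H$ with $d(A_i,A_j)>d$ for all $ij\in E(H)$ that does not contain $H$ as a transversal. Let $$M(H,t)=\sum_{k=0}^{\lfloor n/2\rfloor}(-1)^k m_k(H)\,t^{n-2k}$$ be the matching polynomial of $H$, where $n=|V(H)|$ and $m_k(H)$ is the number of sets of $k$ pairwise disjoint edges of $H$. Then $M(H,t)$ has a largest real root $t(H)$, it satisfies $t(H)>0$, and $$d_{crit}(H)\le 1-\frac{1}{t(H)^2}.$$ If moreover the maximum degree $\Delta(H)$ of $H$ is at least $2$, then $$d_{crit}(H)<1-\frac{1}{4(\Delta(H)-1)}.$$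 -/

import Mathlib

open scoped Polynomial

universe u

/-- A blow-up graph `G[H]` of `H`: a finite simple graph together with a map `proj` onto the vertices
of `H`, whose fibres are the (nonempty) clusters, such that every edge of the graph joins two
clusters whose indices are adjacent in `H`. -/
structure BlowUp {V : Type u} (H : SimpleGraph V) where
  Vert : Type
  [fintypeVert : Fintype Vert]
  graph : SimpleGraph Vert
  proj : graph →g H
  proj_surjective : Function.Surjective proj

attribute [instance] BlowUp.fintypeVert

namespace BlowUp

variable {V : Type u} {H : SimpleGraph V}

open Classical in
/-- The cluster `A_i`. -/
noncomputable def cluster (B : BlowUp H) (i : V) : Finset B.Vert :=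
  Finset.univ.filter fun x => B.proj x = i

open Classical in
/-- The edge density `d(A_i, A_j) = e(A_i, A_j) / (|A_i| |A_j|)`. -/
noncomputable def density (B : BlowUp H) (i j : V) : ℝ :=
  (B.graph.edgeDensity (B.cluster i) (B.cluster j) : ℝ)

theorem density_nonneg (B : BlowUp H) (i j : V) : 0 ≤ B.density i j := by
  classical
  unfold density
  exact_mod_cast B.graph.edgeDensity_nonneg _ _

theorem density_le_one (B : BlowUp H) (i j : V) : B.density i j ≤ 1 := by
  classical
  unfold density
  exact_mod_cast B.graph.edgeDensity_le_one _ _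

/-- `H` is a transversal of the blow-up graph: there is a homomorphism `φ : H → G[H]` with
`φ(i) ∈ A_i` for all `i`. -/
def HasTransversal (B : BlowUp H) : Prop :=
  ∃ φ : H →g B.graph, ∀ i, φ i ∈ B.cluster i

end BlowUp

/-- The critical edge density: the supremum of all `d` such that some blow-up graph of `H` has all
its edge densities larger than `d` and does not contain `H` as a transversal. -/
noncomputable def criticalDensity {V : Type u} (H : SimpleGraph V) : ℝ :=
  sSup {d : ℝ | ∃ B : BlowUp H, (∀ i j, H.Adj i j → d < B.density i j) ∧ ¬ B.HasTransversal}

/-- If `H` has an edge, the supremum in `criticalDensity` is over a nonempty bounded set, and the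
critical density has its two characteristic properties. -/
theorem criticalDensity_spec {V : Type u} [Finite V] (H : SimpleGraph V) (hH : H ≠ ⊥) :
    (∀ B : BlowUp H, (∀ i j, H.Adj i j → criticalDensity H < B.density i j) →
      B.HasTransversal) ∧
    (∀ d < criticalDensity H, ∃ B : BlowUp H,
      (∀ i j, H.Adj i j → d < B.density i j) ∧ ¬ B.HasTransversal) := by
  classical
  obtain ⟨a, b, hab⟩ := SimpleGraph.ne_bot_iff_exists_adj.mp hH
  have hbdd : BddAbove {d : ℝ | ∃ B : BlowUp H,
      (∀ i j, H.Adj i j → d < B.density i j) ∧ ¬ B.HasTransversal} := by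
    refine ⟨1, ?_⟩
    rintro d ⟨B, hB, -⟩
    exact (hB a b hab).le.trans (B.density_le_one a b)
  have hne : {d : ℝ | ∃ B : BlowUp H,
      (∀ i j, H.Adj i j → d < B.density i j) ∧ ¬ B.HasTransversal}.Nonempty := by
    obtain ⟨n, ⟨e⟩⟩ := Finite.exists_equiv_fin V
    refine ⟨-1, ⟨Fin n, ⊥, ⟨e.symm, fun h => h.elim⟩, e.symm.surjective⟩, ?_, ?_⟩
    · intro i j _
      exact lt_of_lt_of_le (by norm_num : (-1 : ℝ) < 0) (BlowUp.density_nonneg _ i j)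
    · rintro ⟨φ, -⟩
      exact φ.map_adj hab
  constructor
  · intro B hB
    by_contra hT
    have hfin : ∃ d, criticalDensity H < d ∧ ∀ i j, H.Adj i j → d < B.density i j := by
      have hf : (Set.range fun p : {p : V × V // H.Adj p.1 p.2} =>
          B.density p.1.1 p.1.2).Finite := Set.finite_range _
      obtain ⟨m, ⟨p, hp⟩, hm⟩ := Set.exists_min_image _ id hf ⟨_, ⟨⟨(a, b), hab⟩, rfl⟩⟩
      obtain ⟨d, hd1, hd2⟩ := exists_between (hB _ _ p.2)
      refine ⟨d, hd1, fun i j hij => hd2.trans_le ?_⟩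
      have := hm _ ⟨⟨(i, j), hij⟩, rfl⟩
      simp only [id] at this
      rw [← hp] at this
      exact this
    obtain ⟨d, hd1, hd2⟩ := hfin
    exact absurd (le_csSup hbdd ⟨B, hd2, hT⟩) (not_le.mpr hd1)
  · intro d hd
    obtain ⟨d', ⟨B, hB, hT⟩, hdd⟩ := exists_lt_of_lt_csSup hne hd
    exact ⟨B, fun i j hij => hdd.trans (hB i j hij), hT⟩

open Classical in
/-- `m_k(H)`: the number of sets of `k` pairwise disjoint edges of `H`. -/
noncomputable def matchingCount {V : Type u} [Fintype V] (H : SimpleGraph V) (k : ℕ) : ℕ :=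
  ((H.edgeFinset.powersetCard k).filter fun S =>
    ∀ e ∈ S, ∀ f ∈ S, ∀ v, v ∈ e → v ∈ f → e = f).card

/-- The matching polynomial `M(H, t) = ∑_{k=0}^{⌊n/2⌋} (-1)^k m_k(H) t^(n-2k)`, `n = |V(H)|`. -/
noncomputable def matchingPoly {V : Type u} [Fintype V] (H : SimpleGraph V) : ℝ[X] :=
  ∑ k ∈ Finset.range (Fintype.card V / 2 + 1),
    Polynomial.C ((-1) ^ k * (matchingCount H k : ℝ)) * Polynomial.X ^ (Fintype.card V - 2 * k)

/-- `t(H)`: the largest (real) root of the matching polynomial. -/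
noncomputable def largestMatchingRoot {V : Type u} [Fintype V] (H : SimpleGraph V) : ℝ :=
  sSup {x : ℝ | (matchingPoly H).IsRoot x}

/-! Choose one vertex in each cluster uniformly and independently. The bad event of an edge `ij` of
`H`, that the chosen pair is not adjacent, has probability `1 - d(A_i, A_j) ≤ p` and is independent
of the choices made for edges disjoint from `ij`. A transversal is an outcome that avoids all bad
events.

By Shearer's local lemma (`pos_of_matchingGen_pos`) such an outcome exists once `Q(p, S) = ∑
(-p)^|T|`, summed over the matchings `T ⊆ S`, is positive for every edge set `S ⊆ E(H)`. By
`matchingGen_pos_of_subset` it suffices that `Q(x, E(H)) > 0` on `[0, p]`. Since `M(H, t) = t^n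
Q(1/t^2, E(H))` and `Q(0, ·) = 1`, this holds for `p < 1/t(H)^2`, which gives the first bound.

The second bound follows from the Heilmann–Lieb estimate `t(H)^2 < 4(Δ - 1)`
(`matchingGen_pos_of_degree_le`). -/

/-! ### Signed matching generating functions and Shearer's lemma -/

section MatchingGenerating

open Classical

variable {V : Type*}

/-- A set of pairwise disjoint edges. -/
def IsMatchingSet (T : Finset (Sym2 V)) : Prop :=
  ∀ e ∈ T, ∀ f ∈ T, ∀ v, v ∈ e → v ∈ f → e = f

/-- The edges of `S` that are disjoint from `e`. -/
noncomputable def edgesAvoiding (S : Finset (Sym2 V)) (e : Sym2 V) : Finset (Sym2 V) :=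
  S.filter fun f => ∀ v ∈ e, v ∉ f

/-- The signed matching generating function of a set of edges. -/
noncomputable def matchingGen (x : ℝ) (S : Finset (Sym2 V)) : ℝ :=
  ∑ T ∈ S.powerset with IsMatchingSet T, (-x) ^ T.card

theorem edgesAvoiding_subset (S : Finset (Sym2 V)) (e : Sym2 V) : edgesAvoiding S e ⊆ S :=
  Finset.filter_subset _ _

theorem mem_edgesAvoiding {S : Finset (Sym2 V)} {e f : Sym2 V} :
    f ∈ edgesAvoiding S e ↔ f ∈ S ∧ ∀ v ∈ e, v ∉ f := by
  simp [edgesAvoiding]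

theorem isMatchingSet_insert {e : Sym2 V} {T : Finset (Sym2 V)} (he : e ∉ T) :
    IsMatchingSet (insert e T) ↔ IsMatchingSet T ∧ ∀ f ∈ T, ∀ v ∈ e, v ∉ f := by
  constructor
  · intro h
    refine ⟨fun a ha b hb => h a (Finset.mem_insert_of_mem ha) b (Finset.mem_insert_of_mem hb),
      fun f hf v hve hvf => he ?_⟩
    rw [h e (Finset.mem_insert_self _ _) f (Finset.mem_insert_of_mem hf) v hve hvf]
    exact hf
  · rintro ⟨h, h'⟩ a ha b hb v hva hvb
    rcases Finset.mem_insert.mp ha with hae | ha <;>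
      rcases Finset.mem_insert.mp hb with hbe | hb
    · rw [hae, hbe]
    · exact absurd hvb (h' b hb v (hae ▸ hva))
    · exact absurd hva (h' a ha v (hbe ▸ hvb))
    · exact h a ha b hb v hva hvb

@[simp]
theorem matchingGen_empty (x : ℝ) : matchingGen x (∅ : Finset (Sym2 V)) = 1 := by
  have : IsMatchingSet (∅ : Finset (Sym2 V)) := by simp [IsMatchingSet]
  simp [matchingGen, Finset.filter_singleton, this]

/-- Split the matchings by whether they contain `e`: removing `e` from one that does leaves a
matching of the edges disjoint from `e`. -/
theorem matchingGen_insert (x : ℝ) {S : Finset (Sym2 V)} {e : Sym2 V} (he : e ∉ S) :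
    matchingGen x (insert e S) = matchingGen x S - x * matchingGen x (edgesAvoiding S e) := by
  unfold matchingGen
  rw [Finset.sum_filter, Finset.sum_powerset_insert he, ← Finset.sum_filter, sub_eq_add_neg]
  congr 1
  rw [← neg_mul, Finset.mul_sum, ← Finset.sum_filter]
  have hset : (S.powerset.filter fun T => IsMatchingSet (insert e T)) =
      (edgesAvoiding S e).powerset.filter fun T => IsMatchingSet T := by
    ext T
    simp only [Finset.mem_filter, Finset.mem_powerset]
    constructor
    · rintro ⟨hT, h⟩
      rw [isMatchingSet_insert fun h => he (hT h)] at h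
      exact ⟨fun f hf => mem_edgesAvoiding.mpr ⟨hT hf, h.2 f hf⟩, h.1⟩
    · rintro ⟨hT, h⟩
      have hTS := hT.trans (edgesAvoiding_subset S e)
      rw [isMatchingSet_insert fun h => he (hTS h)]
      exact ⟨hTS, h, fun f hf => (mem_edgesAvoiding.mp (hT hf)).2⟩
  rw [hset]
  refine Finset.sum_congr rfl fun T hT => ?_
  have hT' : e ∉ T := fun h => he
    (edgesAvoiding_subset S e (Finset.mem_powerset.mp (Finset.mem_filter.mp hT).1 h))
  rw [Finset.card_insert_of_notMem hT', pow_succ']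

theorem matchingGen_zero (S : Finset (Sym2 V)) : matchingGen 0 S = 1 := by
  induction S using Finset.induction_on with
  | empty => simp
  | insert e S he ih => rw [matchingGen_insert 0 he, ih]; simp

theorem continuous_matchingGen (S : Finset (Sym2 V)) : Continuous fun x => matchingGen x S := by
  unfold matchingGen
  fun_prop

/-- Deleting several edges at a common vertex. -/
theorem matchingGen_sdiff_of_common_vertex (x : ℝ) (S : Finset (Sym2 V)) (v : V)
    (F : Finset (Sym2 V)) (hFS : F ⊆ S) (hF : ∀ e ∈ F, v ∈ e) :
    matchingGen x S =
      matchingGen x (S \ F) - x * ∑ e ∈ F, matchingGen x (edgesAvoiding S e) := by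
  induction F using Finset.induction_on with
  | empty => simp
  | insert e F he ih =>
    rw [ih (fun f hf => hFS (Finset.mem_insert_of_mem hf))
      (fun f hf => hF f (Finset.mem_insert_of_mem hf)), Finset.sum_insert he]
    have h1 : S \ F = insert e (S \ insert e F) := by
      ext f
      have := hFS (Finset.mem_insert_self e F)
      by_cases hfe : f = e
      · subst hfe; simp [he, this]
      · simp [hfe]
    have h2 : edgesAvoiding (S \ insert e F) e = edgesAvoiding S e := by
      ext f
      simp only [mem_edgesAvoiding, Finset.mem_sdiff]
      have hve := hF e (Finset.mem_insert_self e F)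
      exact ⟨fun h => ⟨h.1.1, h.2⟩, fun h => ⟨⟨h.1, fun hf => h.2 v hve (hF f hf)⟩, h.2⟩⟩
    rw [h1, matchingGen_insert x (by simp), h2]
    ring

/-- The Heilmann–Lieb bound, in terms of the signed matching generating function. -/
theorem matchingGen_pos_of_degree_le {D x : ℝ} (hx : 0 < x) (hxD : 4 * (D - 1) * x ≤ 1)
    (hD : 2 ≤ D) (S : Finset (Sym2 V))
    (hS : ∀ v, ((S.filter fun e => v ∈ e).card : ℝ) ≤ D) : 0 < matchingGen x S := by
  -- The induction must carry a ratio bound: deleting the edges at a vertex with a spare degree less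
  -- than doubles the value. The factor 2 reproduces itself because `1 - 2(D-1)x ≥ 1/2`.
  suffices h : 0 < matchingGen x S ∧ ∀ v, ((S.filter fun e => v ∈ e).card : ℝ) ≤ D - 1 →
      matchingGen x (S \ S.filter fun e => v ∈ e) < 2 * matchingGen x S from h.1
  induction hn : S.card using Nat.strong_induction_on generalizing S with
  | _ n ih =>
  subst hn
  have mono : ∀ {A B : Finset (Sym2 V)} (v : V), A ⊆ B →
      ((A.filter fun e => v ∈ e).card : ℝ) ≤ (B.filter fun e => v ∈ e).card := by
    intro A B v h
    exact_mod_cast Finset.card_le_card (Finset.filter_subset_filter _ h)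
  have key : ∀ v, (S.filter fun e => v ∈ e).Nonempty →
      0 < matchingGen x (S \ S.filter fun e => v ∈ e) ∧
      matchingGen x (S \ S.filter fun e => v ∈ e) * (1 - 2 * D * x) < matchingGen x S ∧
      (((S.filter fun e => v ∈ e).card : ℝ) ≤ D - 1 →
        matchingGen x (S \ S.filter fun e => v ∈ e) < 2 * matchingGen x S) := by
    intro v hv
    set F := S.filter fun e => v ∈ e with hFdef
    have hFS : F ⊆ S := Finset.filter_subset _ _
    have hlt : (S \ F).card < S.card := Finset.card_lt_card (Finset.sdiff_ssubset hFS hv)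
    obtain ⟨hpos, hrat⟩ := ih _ hlt (S \ F)
      (fun w => (mono w Finset.sdiff_subset).trans (hS w)) rfl
    have hrec := matchingGen_sdiff_of_common_vertex x S v F hFS (by simp [hFdef])
    have hterm : ∀ e ∈ F, matchingGen x (edgesAvoiding S e) < 2 * matchingGen x (S \ F) := by
      intro e he
      obtain ⟨heS, hve⟩ := Finset.mem_filter.mp he
      obtain ⟨w, rfl⟩ := hve
      -- Avoiding `vw` means deleting the edges at `v`, then those at `w`. After the first deletion
      -- `w` has lost `vw`, so its degree is at most `D - 1` and the ratio bound applies.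
      have hav : edgesAvoiding S s(v, w) = (S \ F) \ (S \ F).filter fun e => w ∈ e := by
        ext f
        simp only [mem_edgesAvoiding, Finset.mem_sdiff, Finset.mem_filter, hFdef, Sym2.mem_iff]
        constructor
        · rintro ⟨h, h'⟩
          exact ⟨⟨h, fun h2 => h' v (Or.inl rfl) h2.2⟩, fun h2 => h' w (Or.inr rfl) h2.2⟩
        · rintro ⟨⟨h, h1⟩, h2⟩
          refine ⟨h, ?_⟩
          rintro u (rfl | rfl) hu
          · exact h1 ⟨h, hu⟩
          · exact h2 ⟨⟨h, h1⟩, hu⟩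
      rw [hav]
      refine hrat w ?_
      have hss : ((S \ F).filter fun e => w ∈ e) ⊂ S.filter fun e => w ∈ e := by
        refine Finset.ssubset_iff_of_subset
          (Finset.filter_subset_filter _ Finset.sdiff_subset) |>.mpr ⟨s(v, w), ?_, ?_⟩
        · simp [heS]
        · simp [he]
      have hc : (((S \ F).filter fun e => w ∈ e).card : ℝ) + 1 ≤
          (S.filter fun e => w ∈ e).card := by
        exact_mod_cast Finset.card_lt_card hss
      linarith [hS w]
    have hsum : ∑ e ∈ F, matchingGen x (edgesAvoiding S e) <
        F.card * (2 * matchingGen x (S \ F)) := by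
      rw [← nsmul_eq_mul, ← Finset.sum_const]
      exact Finset.sum_lt_sum_of_nonempty hv hterm
    have hb : ∀ c : ℝ, (F.card : ℝ) ≤ c →
        matchingGen x (S \ F) * (1 - 2 * c * x) < matchingGen x S := by
      intro c hc
      have h1 : ∑ e ∈ F, matchingGen x (edgesAvoiding S e) < c * (2 * matchingGen x (S \ F)) :=
        hsum.trans_le (mul_le_mul_of_nonneg_right hc (by positivity))
      have h2 := mul_lt_mul_of_pos_left h1 hx
      linarith
    refine ⟨hpos, hb D (hS v), fun hc => ?_⟩
    have h1 := hb _ hc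
    have h2 : matchingGen x (S \ F) * (1 / 2) ≤ matchingGen x (S \ F) * (1 - 2 * (D - 1) * x) :=
      mul_le_mul_of_nonneg_left (by linarith) hpos.le
    linarith
  have hpos : 0 < matchingGen x S := by
    rcases S.eq_empty_or_nonempty with rfl | ⟨e, he⟩
    · simp
    induction e using Sym2.ind with
    | _ a b =>
    obtain ⟨h0, h1, -⟩ := key a ⟨s(a, b), by simp [he]⟩
    -- `D ≥ 2` gives `2D ≤ 4(D-1)`.
    have h2 : 0 ≤ 1 - 2 * D * x := by nlinarith
    exact lt_of_le_of_lt (mul_nonneg h0.le h2) h1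
  refine ⟨hpos, fun v hv => ?_⟩
  rcases (S.filter fun e => v ∈ e).eq_empty_or_nonempty with h | h
  · rw [h, Finset.sdiff_empty]
    linarith
  · exact (key v h).2.2 hv

/-- Each edge added to `S` subtracts `x` times a nonnegative value. -/
theorem matchingGen_le_of_subset {x : ℝ} (hx : 0 ≤ x) {S E : Finset (Sym2 V)} (hSE : S ⊆ E)
    (h : ∀ T ⊆ E, 0 ≤ matchingGen x T) : matchingGen x E ≤ matchingGen x S := by
  suffices H : ∀ R ⊆ E, matchingGen x (R ∪ S) ≤ matchingGen x S by
    simpa [Finset.union_eq_left.mpr hSE] using H E subset_rfl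
  intro R
  induction R using Finset.induction_on with
  | empty => simp
  | insert e R _ ih =>
    intro hR
    have hRE : R ⊆ E := (Finset.subset_insert e R).trans hR
    rw [Finset.insert_union]
    by_cases heS : e ∈ R ∪ S
    · rw [Finset.insert_eq_of_mem heS]
      exact ih hRE
    · rw [matchingGen_insert x heS]
      have := mul_nonneg hx (h _ ((edgesAvoiding_subset (R ∪ S) e).trans
        (Finset.union_subset hRE hSE)))
      linarith [ih hRE]

/-- Positivity of the signed matching generating function up to `p` passes to edge subsets. -/
theorem matchingGen_pos_of_subset {p : ℝ} (hp : 0 ≤ p) {E : Finset (Sym2 V)}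
    (hE : ∀ x ∈ Set.Icc 0 p, 0 < matchingGen x E) {S : Finset (Sym2 V)} (hS : S ⊆ E) :
    0 < matchingGen p S := by
  by_contra hneg
  -- The points where positivity fails for some subset. At the least one, all subsets have
  -- nonnegative values by continuity, so the value at `E` is at most that of the failing subset,
  -- hence nonpositive.
  let Z : Set ℝ := Set.Icc 0 p ∩ ⋃ S ∈ (E.powerset : Set (Finset (Sym2 V))),
    {x | matchingGen x S ≤ 0}
  have hZc : IsCompact Z := isCompact_Icc.inter_right <|
    E.powerset.finite_toSet.isClosed_biUnion fun S _ =>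
      isClosed_le (continuous_matchingGen S) continuous_const
  have hZn : Z.Nonempty := by
    refine ⟨p, ⟨hp, le_rfl⟩, ?_⟩
    simp only [Set.mem_iUnion]
    exact ⟨S, by simpa using hS, not_lt.mp hneg⟩
  obtain ⟨x, ⟨hxI, hxU⟩, hmin⟩ := hZc.exists_isLeast hZn
  simp only [Set.mem_iUnion, Set.mem_ofPred_eq] at hxU
  obtain ⟨R, hR, hRx⟩ := hxU
  have hR : R ⊆ E := by simpa using hR
  have hx0 : 0 < x := by
    rcases hxI.1.eq_or_lt with rfl | h
    · rw [matchingGen_zero] at hRx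
      linarith
    · exact h
  have hnn : ∀ T ⊆ E, 0 ≤ matchingGen x T := by
    intro T hT
    have hcl : x ∈ closure (Set.Ico 0 x) := by
      rw [closure_Ico hx0.ne]
      exact ⟨hx0.le, le_rfl⟩
    refine (isClosed_le continuous_const (continuous_matchingGen T)).closure_subset_iff.mpr
      (fun y hy => ?_) hcl
    by_contra hy'
    have hyZ : y ∈ Z := by
      refine ⟨⟨hy.1, hy.2.le.trans hxI.2⟩, ?_⟩
      simp only [Set.mem_iUnion]
      exact ⟨T, by simpa using hT, show matchingGen y T ≤ 0 from (not_le.mp hy').le⟩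
    exact absurd (hmin hyZ) (not_le.mpr hy.2)
  have := matchingGen_le_of_subset hx0.le hR hnn
  linarith [hE x hxI]

/-- Shearer's form of the local lemma for events indexed by edges. -/
theorem pos_of_matchingGen_pos {p : ℝ} (hp : 0 ≤ p) {E : Finset (Sym2 V)}
    (hQ : ∀ S ⊆ E, 0 < matchingGen p S) (F : Finset (Sym2 V) → ℝ) (hF0 : 0 < F ∅)
    (hF : ∀ S ⊆ E, ∀ e ∈ E, F S ≤ F (insert e S) + p * F (edgesAvoiding S e)) :
    0 < F E := by
  -- In cross-multiplied form: the ratio `F S / matchingGen p S` is monotone in `S`. Compare `∅`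
  -- with `E`.
  suffices h : ∀ S ⊆ E, ∀ T ⊆ S, matchingGen p S * F T ≤ F S * matchingGen p T by
    have := h E subset_rfl ∅ (Finset.empty_subset _)
    rw [matchingGen_empty, mul_one] at this
    exact (mul_pos (hQ E subset_rfl) hF0).trans_le this
  intro S
  induction S using Finset.strongInduction with
  | H S ih =>
  intro hS T hT
  rcases eq_or_ssubset_of_subset hT with rfl | hT
  · rw [mul_comm]
  obtain ⟨e, heS, heT⟩ := Finset.exists_of_ssubset hT
  have hss := Finset.erase_ssubset heS
  have hSE := hss.subset.trans hS
  have hins := Finset.insert_erase heS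
  set R := S.erase e with hR
  have hTR : T ⊆ R := Finset.subset_erase.mpr ⟨hT.subset, heT⟩
  have h1 := ih R hss hSE _ (edgesAvoiding_subset R e)
  have h2 := ih R hss hSE T hTR
  have h3 := hF R hSE e (hS heS)
  have h4 := matchingGen_insert p (Finset.notMem_erase e S)
  rw [← hR] at h4
  rw [hins] at h3 h4
  have hRpos := hQ R hSE
  have hTpos := hQ T (hT.subset.trans hS)
  have h5 : F R * matchingGen p S ≤ matchingGen p R * F S := by
    rw [h4]
    have := mul_le_mul_of_nonneg_left h1 hp
    have := mul_le_mul_of_nonneg_left h3 hRpos.le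
    linarith
  refine le_of_mul_le_mul_left ?_ hRpos
  calc matchingGen p R * (matchingGen p S * F T)
      = matchingGen p S * (matchingGen p R * F T) := by ring
    _ ≤ matchingGen p S * (F R * matchingGen p T) := mul_le_mul_of_nonneg_left h2 (hQ S hS).le
    _ = (F R * matchingGen p S) * matchingGen p T := by ring
    _ ≤ (matchingGen p R * F S) * matchingGen p T := mul_le_mul_of_nonneg_right h5 hTpos.le
    _ = matchingGen p R * (F S * matchingGen p T) := by ring

end MatchingGenerating

/-! ### Counting partial transversals -/

section Transversals

open Classical

variable {V : Type*} {H : SimpleGraph V}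

namespace BlowUp

theorem cluster_nonempty (B : BlowUp H) (i : V) : (B.cluster i).Nonempty := by
  obtain ⟨x, hx⟩ := B.proj_surjective i
  exact ⟨x, by simp [cluster, hx]⟩

variable [Fintype V]

/-- The choices of one vertex per cluster that respect all edges in `S`. -/
noncomputable def partialTransversals (B : BlowUp H) (S : Finset (Sym2 V)) :
    Finset (V → B.Vert) :=
  (Fintype.piFinset B.cluster).filter fun φ => ∀ i j, s(i, j) ∈ S → B.graph.Adj (φ i) (φ j)

theorem mem_partialTransversals (B : BlowUp H) {S : Finset (Sym2 V)} {φ : V → B.Vert} :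
    φ ∈ B.partialTransversals S ↔
      (∀ i, φ i ∈ B.cluster i) ∧ ∀ i j, s(i, j) ∈ S → B.graph.Adj (φ i) (φ j) := by
  simp [partialTransversals]

theorem partialTransversals_empty_nonempty (B : BlowUp H) :
    (B.partialTransversals ∅).Nonempty := by
  choose φ hφ using B.cluster_nonempty
  exact ⟨φ, by simpa [mem_partialTransversals] using hφ⟩

theorem hasTransversal_of_nonempty (B : BlowUp H)
    (h : (B.partialTransversals H.edgeFinset).Nonempty) : B.HasTransversal := by
  obtain ⟨φ, hφ⟩ := h
  rw [mem_partialTransversals] at hφ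
  exact ⟨⟨φ, fun {i j} hij => hφ.2 i j (by simpa using hij)⟩, hφ.1⟩

/-- The event that `ab` is not respected is independent of the edges disjoint from `ab`. -/
theorem card_partialTransversals_not_adj (B : BlowUp H) {a b : V} (hab : a ≠ b)
    {S : Finset (Sym2 V)} (hS : ∀ e ∈ S, a ∉ e ∧ b ∉ e) :
    (((B.partialTransversals S).filter fun φ => ¬ B.graph.Adj (φ a) (φ b)).card : ℝ) =
      (1 - B.density a b) * (B.partialTransversals S).card := by
  set G := B.partialTransversals S with hG
  have hupd : ∀ φ ∈ G, ∀ x ∈ B.cluster a, ∀ y ∈ B.cluster b,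
      Function.update (Function.update φ a x) b y ∈ G := by
    intro φ hφ x hx y hy
    rw [hG, mem_partialTransversals] at hφ ⊢
    constructor
    · intro i
      by_cases hib : i = b
      · subst hib; simpa using hy
      · by_cases hia : i = a
        · subst hia; simpa [hib] using hx
        · simpa [hib, hia] using hφ.1 i
    · intro i j hij
      obtain ⟨h1, h2⟩ := hS _ hij
      simp only [Sym2.mem_iff, not_or] at h1 h2
      rw [Function.update_of_ne (Ne.symm h2.1), Function.update_of_ne (Ne.symm h1.1),
        Function.update_of_ne (Ne.symm h2.2), Function.update_of_ne (Ne.symm h1.2)]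
      exact hφ.2 i j hij
  have hmem : ∀ φ ∈ G, ∀ i, φ i ∈ B.cluster i := fun φ hφ =>
    (B.mem_partialTransversals.mp hφ).1
  let W := (B.cluster a ×ˢ B.cluster b).filter fun z => ¬ B.graph.Adj z.1 z.2
  -- Exchanging the values of `φ` at `a`, `b` with the pair `(x, y)` is an involution; it moves the
  -- non-adjacency condition from `φ` to the pair.
  have hswap : ((G.filter fun φ => ¬ B.graph.Adj (φ a) (φ b)) ×ˢ
      (B.cluster a ×ˢ B.cluster b)).card = (G ×ˢ W).card := by
    refine Finset.card_nbij'
      (fun q => (Function.update (Function.update q.1 a q.2.1) b q.2.2, (q.1 a, q.1 b)))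
      (fun q => (Function.update (Function.update q.1 a q.2.1) b q.2.2, (q.1 a, q.1 b)))
      ?_ ?_ ?_ ?_
    · rintro ⟨φ, x, y⟩ h
      simp only [Finset.coe_product, Finset.coe_filter, Set.mem_prod, Set.mem_ofPred_eq,
        Finset.mem_coe] at h
      obtain ⟨⟨hφ, hna⟩, hx, hy⟩ := h
      simp only [W, Finset.coe_product, Finset.coe_filter, Set.mem_prod, Set.mem_ofPred_eq,
        Finset.mem_coe, Finset.mem_product]
      exact ⟨hupd φ hφ x hx y hy, ⟨hmem φ hφ a, hmem φ hφ b⟩, hna⟩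
    · rintro ⟨φ, x, y⟩ h
      simp only [W, Finset.coe_product, Finset.coe_filter, Set.mem_prod, Set.mem_ofPred_eq,
        Finset.mem_coe, Finset.mem_product] at h
      obtain ⟨hφ, ⟨hx, hy⟩, hna⟩ := h
      simp only [Finset.coe_product, Finset.coe_filter, Set.mem_prod, Set.mem_ofPred_eq,
        Finset.mem_coe]
      exact ⟨⟨hupd φ hφ x hx y hy, by simpa [hab] using hna⟩, hmem φ hφ a, hmem φ hφ b⟩
    all_goals
      rintro ⟨φ, x, y⟩ -
      simp only [Function.update_self, Function.update_of_ne hab, Prod.mk.injEq, and_true]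
      ext i
      by_cases hib : i = b
      · subst hib; simp
      · by_cases hia : i = a
        · subst hia; simp [hib]
        · simp [hib, hia]
  have hA : ((B.cluster a).card : ℝ) ≠ 0 := by
    exact_mod_cast (Finset.card_pos.mpr (B.cluster_nonempty a)).ne'
  have hB : ((B.cluster b).card : ℝ) ≠ 0 := by
    exact_mod_cast (Finset.card_pos.mpr (B.cluster_nonempty b)).ne'
  have hdens : B.density a b * ((B.cluster a).card * (B.cluster b).card) =
      ((B.cluster a ×ˢ B.cluster b).filter fun z => B.graph.Adj z.1 z.2).card := by
    rw [density, SimpleGraph.edgeDensity_def]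
    push_cast
    rw [div_mul_cancel₀ _ (mul_ne_zero hA hB)]
    rfl
  have hW : (((B.cluster a ×ˢ B.cluster b).filter fun z => B.graph.Adj z.1 z.2).card : ℝ) +
      W.card = (B.cluster a).card * (B.cluster b).card := by
    exact_mod_cast (Finset.card_filter_add_card_filter_not (s := B.cluster a ×ˢ B.cluster b)
      (fun z => B.graph.Adj z.1 z.2)).trans (Finset.card_product _ _)
  rw [Finset.card_product, Finset.card_product, Finset.card_product] at hswap
  have hswap' : ((G.filter fun φ => ¬ B.graph.Adj (φ a) (φ b)).card : ℝ) *
      ((B.cluster a).card * (B.cluster b).card) = G.card * W.card := by exact_mod_cast hswap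
  refine mul_right_cancel₀ (mul_ne_zero hA hB) ?_
  rw [hswap']
  linear_combination (G.card : ℝ) * hW + (G.card : ℝ) * hdens

/-- The recursive hypothesis of Shearer's lemma. A choice respecting `S` either respects `e` too, or
violates `e` while respecting the edges disjoint from it; independence counts the latter. -/
theorem card_partialTransversals_le (B : BlowUp H) {p : ℝ} {e : Sym2 V} (he : e ∈ H.edgeFinset)
    (hp : ∀ i j, H.Adj i j → 1 - B.density i j ≤ p) (S : Finset (Sym2 V)) :
    ((B.partialTransversals S).card : ℝ) ≤ (B.partialTransversals (insert e S)).card +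
      p * (B.partialTransversals (edgesAvoiding S e)).card := by
  induction e using Sym2.ind with
  | _ a b =>
  have hab : H.Adj a b := by simpa using he
  have h1 := B.card_partialTransversals_not_adj hab.ne (S := edgesAvoiding S s(a, b))
    fun e he => ⟨(mem_edgesAvoiding.mp he).2 a (by simp), (mem_edgesAvoiding.mp he).2 b (by simp)⟩
  have h2 := mul_le_mul_of_nonneg_right (hp a b hab)
    (Nat.cast_nonneg' (α := ℝ) (B.partialTransversals (edgesAvoiding S s(a, b))).card)
  have h3 : (B.partialTransversals S).card ≤ (B.partialTransversals (insert s(a, b) S)).card +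
      ((B.partialTransversals (edgesAvoiding S s(a, b))).filter
        fun φ => ¬ B.graph.Adj (φ a) (φ b)).card := by
    refine (Finset.card_le_card fun φ hφ => ?_).trans (Finset.card_union_le _ _)
    rw [mem_partialTransversals] at hφ
    rw [Finset.mem_union, Finset.mem_filter, mem_partialTransversals, mem_partialTransversals]
    by_cases h : B.graph.Adj (φ a) (φ b)
    · refine Or.inl ⟨hφ.1, fun i j hij => ?_⟩
      rcases Finset.mem_insert.mp hij with hij | hij
      · rcases Sym2.eq_iff.mp hij with ⟨rfl, rfl⟩ | ⟨rfl, rfl⟩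
        · exact h
        · exact h.symm
      · exact hφ.2 i j hij
    · exact Or.inr ⟨⟨hφ.1, fun i j hij => hφ.2 i j (edgesAvoiding_subset _ _ hij)⟩, h⟩
  have h3' : ((B.partialTransversals S).card : ℝ) ≤
      (B.partialTransversals (insert s(a, b) S)).card +
      ((B.partialTransversals (edgesAvoiding S s(a, b))).filter
        fun φ => ¬ B.graph.Adj (φ a) (φ b)).card := by exact_mod_cast h3
  linarith

theorem hasTransversal_of_matchingGen_pos (B : BlowUp H) {p : ℝ} (hp0 : 0 ≤ p)
    (hp : ∀ i j, H.Adj i j → 1 - B.density i j ≤ p)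
    (hQ : ∀ S ⊆ H.edgeFinset, 0 < matchingGen p S) : B.HasTransversal := by
  refine B.hasTransversal_of_nonempty (Finset.card_pos.mp ?_)
  have := pos_of_matchingGen_pos hp0 hQ (fun S => ((B.partialTransversals S).card : ℝ))
    (by exact_mod_cast Finset.card_pos.mpr B.partialTransversals_empty_nonempty)
    (fun S _ e he => B.card_partialTransversals_le he hp S)
  exact_mod_cast this

end BlowUp

end Transversals

/-! ### The matching polynomial and its largest root -/

section MatchingPolynomial

open Classical

variable {V : Type*} [Fintype V] (H : SimpleGraph V)

theorem two_mul_card_le_of_isMatchingSet {T : Finset (Sym2 V)} (hT : T ⊆ H.edgeFinset)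
    (hM : IsMatchingSet T) : 2 * T.card ≤ Fintype.card V := by
  have h : (T.biUnion fun e => e.toFinset).card = ∑ e ∈ T, e.toFinset.card := by
    refine Finset.card_biUnion fun e he f hf hef => ?_
    refine Finset.disjoint_left.mpr ?_
    intro v hve hvf
    exact hef (hM e he f hf v (by simpa using hve) (by simpa using hvf))
  have h2 : ∑ e ∈ T, e.toFinset.card = ∑ e ∈ T, 2 := by
    refine Finset.sum_congr rfl fun e he => Sym2.card_toFinset_of_not_isDiag e ?_
    exact H.not_isDiag_of_mem_edgeSet (by simpa using hT he)
  rw [Finset.sum_const, smul_eq_mul, mul_comm] at h2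
  rw [← h2, ← h]
  exact Finset.card_le_univ _

theorem matchingPoly_eval {t : ℝ} (ht : t ≠ 0) :
    (matchingPoly H).eval t =
      t ^ Fintype.card V * matchingGen (1 / t ^ 2) H.edgeFinset := by
  have hfib : ∀ T ∈ H.edgeFinset.powerset.filter IsMatchingSet,
      T.card ∈ Finset.range (Fintype.card V / 2 + 1) := by
    intro T hT
    rw [Finset.mem_filter, Finset.mem_powerset] at hT
    have := two_mul_card_le_of_isMatchingSet H hT.1 hT.2
    rw [Finset.mem_range]
    omega
  unfold matchingGen
  rw [← Finset.sum_fiberwise_of_maps_to hfib, Finset.mul_sum, matchingPoly,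
    Polynomial.eval_finsetSum]
  refine Finset.sum_congr rfl fun k hk => ?_
  have hk : 2 * k ≤ Fintype.card V := by
    rw [Finset.mem_range] at hk
    omega
  have hset : ((H.edgeFinset.powerset.filter IsMatchingSet).filter fun T => T.card = k) =
      (H.edgeFinset.powersetCard k).filter IsMatchingSet := by
    ext T
    simp only [Finset.mem_filter, Finset.mem_powerset, Finset.mem_powersetCard]
    tauto
  have hsum : ∑ T ∈ (H.edgeFinset.powerset.filter IsMatchingSet).filter (fun T => T.card = k),
      (-(1 / t ^ 2)) ^ T.card = (matchingCount H k : ℝ) * (-(1 / t ^ 2)) ^ k := by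
    rw [Finset.sum_congr rfl fun T hT => by rw [(Finset.mem_filter.mp hT).2], Finset.sum_const,
      nsmul_eq_mul, hset]
    unfold matchingCount IsMatchingSet
    congr!
  rw [hsum]
  simp only [Polynomial.eval_mul, Polynomial.eval_C, Polynomial.eval_pow, Polynomial.eval_X]
  have hpow : t ^ Fintype.card V = t ^ (Fintype.card V - 2 * k) * (t ^ 2) ^ k := by
    rw [← pow_mul, ← pow_add, Nat.sub_add_cancel hk]
  have hc : (t ^ 2) ^ k * (-(1 / t ^ 2)) ^ k = (-1) ^ k := by
    rw [← mul_pow]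
    congr 1
    field_simp
  rw [hpow, ← hc]
  ring

theorem isRoot_matchingPoly_iff {t : ℝ} (ht : t ≠ 0) :
    (matchingPoly H).IsRoot t ↔ matchingGen (1 / t ^ 2) H.edgeFinset = 0 := by
  rw [Polynomial.IsRoot, matchingPoly_eval H ht, mul_eq_zero, or_iff_right (pow_ne_zero _ ht)]

theorem card_filter_mem_edgeFinset_eq_degree (v : V) :
    (H.edgeFinset.filter fun e => v ∈ e).card = H.degree v := by
  rw [← H.card_incidenceFinset_eq_degree, H.incidenceFinset_eq_filter]

/-- Needed so that the root set is finite and its supremum is attained. -/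
theorem matchingPoly_ne_zero : matchingPoly H ≠ 0 := by
  intro h0
  obtain ⟨c, hcdef⟩ : ∃ c : ℝ, c = (Fintype.card V : ℝ) := ⟨_, rfl⟩
  have hc : 0 ≤ c := hcdef ▸ Nat.cast_nonneg _
  -- With `t = 2(c + 1)` and `x = 1/t^2`, `4(D - 1)x = 1/(c + 1) ≤ 1`, so `t` is not a root.
  have hpos := matchingGen_pos_of_degree_le (D := c + 2) (x := 1 / (2 * (c + 1)) ^ 2)
    (by positivity) (by
      rw [mul_one_div, div_le_one (by positivity)]
      nlinarith) (by linarith) H.edgeFinset (fun v => by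
      rw [card_filter_mem_edgeFinset_eq_degree]
      have : (H.degree v : ℝ) ≤ c := by
        rw [hcdef]
        exact_mod_cast (H.degree_lt_card_verts v).le
      linarith)
  have ht : (2 * (c + 1)) ≠ 0 := by positivity
  refine hpos.ne' ((isRoot_matchingPoly_iff H ht).mp ?_)
  simp [h0]

variable {H}

theorem exists_pos_isRoot_of_matchingGen_nonpos {x : ℝ} (hx : 0 ≤ x)
    (h : matchingGen x H.edgeFinset ≤ 0) :
    ∃ t : ℝ, 0 < t ∧ (matchingPoly H).IsRoot t ∧ 1 / t ^ 2 ≤ x := by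
  obtain ⟨y, hy, hy0⟩ := intermediate_value_Icc' hx
    (continuous_matchingGen H.edgeFinset).continuousOn
    (show (0 : ℝ) ∈ Set.Icc (matchingGen x H.edgeFinset) (matchingGen 0 H.edgeFinset) from
      ⟨h, by rw [matchingGen_zero]; exact zero_le_one⟩)
  have hypos : 0 < y := by
    rcases hy.1.eq_or_lt with rfl | h
    · simp [matchingGen_zero] at hy0
    · exact h
  have hsq : 1 / (1 / √y) ^ 2 = y := by
    rw [div_pow, Real.sq_sqrt hypos.le]
    simp
  have htpos : 0 < 1 / √y := by positivity
  exact ⟨1 / √y, htpos, (isRoot_matchingPoly_iff H htpos.ne').mpr (by rwa [hsq]),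
    hsq.le.trans hy.2⟩

theorem exists_pos_isRoot_matchingPoly (hH : H ≠ ⊥) :
    ∃ t : ℝ, 0 < t ∧ (matchingPoly H).IsRoot t := by
  obtain ⟨a, b, hab⟩ := SimpleGraph.ne_bot_iff_exists_adj.mp hH
  by_contra! hno
  -- Without positive roots, positivity would hold on `[0, 1]` and pass to a single edge, whose
  -- value at 1 is `1 - 1 = 0`.
  have hpos : 0 < matchingGen 1 {s(a, b)} := by
    refine matchingGen_pos_of_subset zero_le_one (E := H.edgeFinset) (fun x hx => ?_) (by simpa)
    by_contra! hneg
    obtain ⟨t, ht, hroot, -⟩ := exists_pos_isRoot_of_matchingGen_nonpos hx.1 hneg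
    exact hno t ht hroot
  have h := matchingGen_insert 1 (Finset.notMem_empty s(a, b))
  simp [edgesAvoiding] at h
  exact hpos.ne' h

theorem isGreatest_largestMatchingRoot (hH : H ≠ ⊥) :
    IsGreatest {x : ℝ | (matchingPoly H).IsRoot x} (largestMatchingRoot H) := by
  have hfin := Polynomial.finite_setOfPred_isRoot (matchingPoly_ne_zero H)
  obtain ⟨t, -, ht⟩ := exists_pos_isRoot_matchingPoly hH
  exact ⟨Set.Nonempty.csSup_mem ⟨t, ht⟩ hfin, fun x hx => le_csSup hfin.bddAbove hx⟩

theorem largestMatchingRoot_pos (hH : H ≠ ⊥) : 0 < largestMatchingRoot H := by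
  obtain ⟨t, ht, hroot⟩ := exists_pos_isRoot_matchingPoly hH
  exact ht.trans_le ((isGreatest_largestMatchingRoot hH).2 hroot)

theorem matchingGen_pos_of_lt_one_div_sq (hH : H ≠ ⊥) {x : ℝ} (hx : 0 ≤ x)
    (hlt : x < 1 / largestMatchingRoot H ^ 2) : 0 < matchingGen x H.edgeFinset := by
  by_contra! hneg
  obtain ⟨t, ht, hroot, hle⟩ := exists_pos_isRoot_of_matchingGen_nonpos hx hneg
  have h1 : t ≤ largestMatchingRoot H := (isGreatest_largestMatchingRoot hH).2 hroot
  have h2 : 1 / largestMatchingRoot H ^ 2 ≤ 1 / t ^ 2 := by gcongr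
  linarith

theorem criticalDensity_le (hH : H ≠ ⊥) :
    criticalDensity H ≤ 1 - 1 / largestMatchingRoot H ^ 2 := by
  by_contra! hlt
  obtain ⟨d, hd1, hd2⟩ := exists_between hlt
  obtain ⟨B, hB, hT⟩ := (criticalDensity_spec H hH).2 d hd2
  obtain ⟨a, b, hab⟩ := SimpleGraph.ne_bot_iff_exists_adj.mp hH
  have hd : 0 ≤ 1 - d := by linarith [hB a b hab, B.density_le_one a b]
  refine hT (B.hasTransversal_of_matchingGen_pos hd
    (fun i j hij => by linarith [hB i j hij]) fun S hS => ?_)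
  exact matchingGen_pos_of_subset hd (fun x hx =>
    matchingGen_pos_of_lt_one_div_sq hH hx.1 (by linarith [hx.2])) hS

theorem one_div_lt_one_div_largestMatchingRoot_sq (hH : H ≠ ⊥) {D : ℕ} (hD : 2 ≤ D)
    (hdeg : ∀ v, H.degree v ≤ D) :
    1 / (4 * ((D : ℝ) - 1)) < 1 / largestMatchingRoot H ^ 2 := by
  by_contra! hle
  have hD' : (2 : ℝ) ≤ D := by exact_mod_cast hD
  -- Strictness comes from the Heilmann–Lieb bound including the endpoint `4(D - 1)x = 1`.
  have hpos := matchingGen_pos_of_degree_le (x := 1 / largestMatchingRoot H ^ 2) (D := D)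
    (one_div_pos.mpr (pow_pos (largestMatchingRoot_pos hH) 2)) (by
      have := mul_le_mul_of_nonneg_left hle (show 0 ≤ 4 * ((D : ℝ) - 1) by linarith)
      rwa [mul_one_div_cancel (by linarith)] at this) hD' H.edgeFinset
    (fun v => by
      rw [card_filter_mem_edgeFinset_eq_degree]
      exact_mod_cast hdeg v)
  exact hpos.ne' ((isRoot_matchingPoly_iff H (largestMatchingRoot_pos hH).ne').mp
    (isGreatest_largestMatchingRoot hH).1)

end MatchingPolynomial

/-- The first two conjuncts say that `t(H)` really is the largest root and is positive, so that
`1 / t(H)^2` has its intended meaning. -/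
theorem mainTheorem4 {V : Type*} [Fintype V] (H : SimpleGraph V) [DecidableRel H.Adj]
    (hH : H ≠ ⊥) :
    IsGreatest {x : ℝ | (matchingPoly H).IsRoot x} (largestMatchingRoot H) ∧
    0 < largestMatchingRoot H ∧
    criticalDensity H ≤ 1 - 1 / largestMatchingRoot H ^ 2 ∧
    (2 ≤ H.maxDegree → criticalDensity H < 1 - 1 / (4 * ((H.maxDegree : ℝ) - 1))) := by
  refine ⟨isGreatest_largestMatchingRoot hH, largestMatchingRoot_pos hH, criticalDensity_le hH,
    fun hΔ => ?_⟩
  have := one_div_lt_one_div_largestMatchingRoot_sq hH hΔ (fun v => by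
    convert H.degree_le_maxDegree v)
  linarith [criticalDensity_le hH]
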